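/- **Theorem (Stochastic-approximation tracking).** *The game.* A task $\tau$ is drawn from a discrete law; its $T_\tau$ decision units are played in order. In the state $m=(\tau,u,\text{partial output})$ the generator proposes $x\sim\pi^x_{f,\phi}(\cdot\mid m)$. The verifier stays silent or raises a safety assurance case (SAC) $s$, according to $\pi_{v,\theta}(\cdot\mid m,x)$. After a SAC the generator drafts $z\sim\pi^z_{f,\phi}(\cdot\mid m,x,s)$ and chooses $a\in\{\mathrm{KEEP},\mathrm{REVISE}\}$ by $\pi^a_{f,\phi}(\cdot\mid m,x,s,z)$; the submitted component is $z$ if $a=\mathrm{REVISE}$, and $x$ otherwise. Here $\phi\in\mathbb R^p$ and $\theta\in\mathbb R^q$. For bounded episode rewards $R_f,R_v$, fixed reference policies and real coefficients $\beta$, let $$J_f(\phi;\theta)=\mathbb E_{\phi,\theta}[R_f]-\sum_{i\in\{x,z,a\}}\beta_{fi}\,\mathbb E_{I^i_f}\big[\mathrm{KL}(\pi^i_{f,\phi}\,\|\,\pi^i_{f,\mathrm{ref}})\big],\qquad J_v(\theta;\phi)=\mathbb E_{\phi,\theta}[R_v]-\beta_v\,\mathbb E_{I_v}\big[\mathrm{KL}(\pi_{v,\theta}\,\|\,\pi_{v,\mathrm{ref}})\big],$$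 where a decision context $I$ of a given kind has probability proportional to its expected number of occurrences in an episode. The game vector field is $F(\phi,\theta)=(\nabla_\phi J_f(\phi;\theta),\nabla_\theta J_v(\theta;\phi))$. *Assumptions.* Let $K_f\subset\mathbb R^p$ and $K_v\subset\mathbb R^q$ be compact. On an open set $U\supseteq K_f\times K_v$ the KL terms are finite, $J_f$ and $J_v$ are $C^1$, and $F$ is locally Lipschitz. Let $\eta_t>0$ with $\sum_t\eta_t=\infty$ and $\sum_t\eta_t^2<\infty$. Let $M^f_{t+1},M^v_{t+1}$ be martingale differences for a filtration $(\mathcal F_t)$ with bounded second moments. Let $b^f_t,b^v_t$ be random vectors (not necessarily adapted) with $\sum_t\eta_t(\|b^f_t\|+\|b^v_t\|)<\infty$ almost surely. Almost surely, for all $t$, $\phi_t\in K_f$, $\theta_t\in K_v$ and $$\phi_{t+1}=\phi_t+\eta_t\big(\nabla_\phi J_f(\phi_t;\theta_t)+M^f_{t+1}+b^f_t\big),\qquad \theta_{t+1}=\theta_t+\eta_t\big(\nabla_\theta J_v(\theta_t;\phi_{t+1})+M^v_{t+1}+b^v_t\big).$$ (If the iterates are kept in the compact sets by a projection, its displacement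 is counted in the bias terms.) *Conclusions.* Let $X:[0,\infty)\to\mathbb R^{p}\times\mathbb R^q$ be the piecewise linear interpolation of $(\phi_t,\theta_t)$ at the times $\sum_{k<t}\eta_k$. 1. Almost surely $X$ is an asymptotic pseudo-trajectory of the game ODE $\dot\phi=\nabla_\phi J_f$, $\dot\theta=\nabla_\theta J_v$: $X$ is continuous and, for every $T>0$, for all large $t$ the solution $y_t$ of the ODE with $y_t(0)=X(t)$ exists in $U$ on $[0,T]$, and $\sup_{0\le s\le T}\|X(t+s)-y_t(s)\|\to0$ as $t\to\infty$. 2. Almost surely, every isolated point $(\phi,\theta)$ of the set of limit points of $(\phi_t,\theta_t)$ satisfies $\nabla_\phi J_f(\phi;\theta)=0$ and $\nabla_\theta J_v(\theta;\phi)=0$. 3. The same two equations hold at every $(\phi,\theta)\in U$ that is asymptotically stable (Lyapunov stable and locally attracting, without presupposing that it is an equilibrium) for the game ODE. In particular, every isolated asymptotically stable limit point is a stationary point where both role gradients vanish. -/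

import Mathlib

open Filter Topology MeasureTheory
open scoped ENNReal

noncomputable section

/-! ### The generator-verifier Markov game -/

/-- The state `m_t = (task, current decision unit, partial output so far)`. -/
structure GameState (Task DU Out : Type*) where
  task : Task
  decisionUnit : DU
  outputs : List Out

/-- The generator's answer to a safety assurance case (SAC). -/
inductive RevisionAction where
  | keep
  | revise

/-- The record of one decision unit: either the verifier stays silent on the proposal `x`, or it
raises the safety assurance case `s`, the generator drafts the candidate revision `z` and then
chooses `a`. The type `S` holds the contents (claim, argument, evidence) of a SAC. -/
inductive DecisionRecord (Out S : Type*) where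
  | silent (x : Out)
  | challenged (x : Out) (s : S) (z : Out) (a : RevisionAction)

/-- The submitted output component. -/
def DecisionRecord.output {Out S : Type*} : DecisionRecord Out S → Out
  | .silent x => x
  | .challenged x _ _ .keep => x
  | .challenged _ _ z .revise => z

/-- The initial proposal. -/
def DecisionRecord.proposal {Out S : Type*} : DecisionRecord Out S → Out
  | .silent x => x
  | .challenged x _ _ _ => x

/-- The three decision rules of the generator: initial proposal, candidate revision, and the
choice between KEEP and REVISE. -/
structure GeneratorPolicy (Task DU Out S : Type*) where
  propose : GameState Task DU Out → PMF Out
  candidate : GameState Task DU Out → Out → S → PMF Out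
  respond : GameState Task DU Out → Out → S → Out → PMF RevisionAction

/-- The verifier sees the state and the proposal; `none` is no-SAC and `some s` is the SAC `s`. -/
abbrev VerifierPolicy (Task DU Out S : Type*) : Type _ :=
  GameState Task DU Out → Out → PMF (Option S)

/-- A play of the game: the task and the records of its decision units, in order. -/
abbrev Episode (Task Out S : Type*) : Type _ := Task × List (DecisionRecord Out S)

/-- A finite-horizon two-player generator-verifier game with parametrized policies: the generator's
parameter is `φ ∈ ℝ^p`, the verifier's is `θ ∈ ℝ^q`. The rewards are arbitrary real functions of the
whole episode. -/
structure GVGame (p q : ℕ) (Task DU Out S : Type*) where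
  taskLaw : PMF Task
  horizon : Task → ℕ
  decisionUnit : Task → ℕ → DU
  rewardF : Episode Task Out S → ℝ
  rewardV : Episode Task Out S → ℝ
  gen : EuclideanSpace ℝ (Fin p) → GeneratorPolicy Task DU Out S
  ver : EuclideanSpace ℝ (Fin q) → VerifierPolicy Task DU Out S
  genRef : GeneratorPolicy Task DU Out S
  verRef : VerifierPolicy Task DU Out S
  betaV : ℝ
  betaFX : ℝ
  betaFZ : ℝ
  betaFA : ℝ

/-- Kullback-Leibler divergence of discrete distributions. -/
def pmfKL {α : Type*} (a b : PMF α) : ℝ≥0∞ :=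
  letI : MeasurableSpace α := ⊤
  InformationTheory.klDiv a.toMeasure b.toMeasure

namespace GVGame

variable {p q : ℕ} {Task DU Out S : Type*} (G : GVGame p q Task DU Out S)

/-- The state reached after the decision records `h`. -/
def stateAfter (τ : Task) (h : List (DecisionRecord Out S)) : GameState Task DU Out :=
  ⟨τ, G.decisionUnit τ h.length, h.map DecisionRecord.output⟩

/-- The law of the record of the decision unit played in the state `m`. -/
def stepLaw (φ : EuclideanSpace ℝ (Fin p)) (θ : EuclideanSpace ℝ (Fin q))
    (m : GameState Task DU Out) : PMF (DecisionRecord Out S) :=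
  ((G.gen φ).propose m).bind fun x =>
    (G.ver θ m x).bind fun y =>
      match y with
      | none => PMF.pure (.silent x)
      | some s =>
        ((G.gen φ).candidate m x s).bind fun z =>
          ((G.gen φ).respond m x s z).map fun a => .challenged x s z a

/-- Play `n` more decision units after the records `h`. -/
def rollout (φ : EuclideanSpace ℝ (Fin p)) (θ : EuclideanSpace ℝ (Fin q)) (τ : Task) :
    ℕ → List (DecisionRecord Out S) → PMF (List (DecisionRecord Out S))
  | 0, h => PMF.pure h
  | n + 1, h =>
    (G.stepLaw φ θ (G.stateAfter τ h)).bind fun r => rollout φ θ τ n (h ++ [r])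

/-- The law `d^{φ,θ}` of an episode. -/
def episodeLaw (φ : EuclideanSpace ℝ (Fin p)) (θ : EuclideanSpace ℝ (Fin q)) :
    PMF (Episode Task Out S) :=
  G.taskLaw.bind fun τ => (G.rollout φ θ τ (G.horizon τ) []).map fun h => (τ, h)

/-- The unregularized expected reward of a reward function `R`. -/
def expectedReward (R : Episode Task Out S → ℝ) (φ : EuclideanSpace ℝ (Fin p))
    (θ : EuclideanSpace ℝ (Fin q)) : ℝ :=
  ∑' e, (G.episodeLaw φ θ e).toReal * R e

/-- The successive states of an episode, each with the record of its decision unit. -/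
def decisions (e : Episode Task Out S) : List (GameState Task DU Out × DecisionRecord Out S) :=
  e.2.mapIdx fun i r => (G.stateAfter e.1 (e.2.take i), r)

/-- The mean of `c` over the decision contexts of one kind. Here `c` returns `none` where a decision
of that kind is not taken, and a context has the probability proportional to its expected number of
occurrences in an episode. -/
def contextMean (c : GameState Task DU Out × DecisionRecord Out S → Option ℝ≥0∞)
    (φ : EuclideanSpace ℝ (Fin p)) (θ : EuclideanSpace ℝ (Fin q)) : ℝ≥0∞ :=
  (∑' e, G.episodeLaw φ θ e * ((G.decisions e).filterMap c).sum) /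
    (∑' e, G.episodeLaw φ θ e * (((G.decisions e).filterMap c).length : ℝ≥0∞))

/-- Verifier contexts: state and proposal. -/
def klV (φ : EuclideanSpace ℝ (Fin p)) (θ : EuclideanSpace ℝ (Fin q)) : ℝ≥0∞ :=
  G.contextMean
    (fun d => some (pmfKL (G.ver θ d.1 d.2.proposal) (G.verRef d.1 d.2.proposal))) φ θ

/-- Generator contexts for the initial proposal: the state. -/
def klFX (φ : EuclideanSpace ℝ (Fin p)) (θ : EuclideanSpace ℝ (Fin q)) : ℝ≥0∞ :=
  G.contextMean (fun d => some (pmfKL ((G.gen φ).propose d.1) (G.genRef.propose d.1))) φ θ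

/-- Generator contexts for the candidate revision: state, proposal, SAC. -/
def klFZ (φ : EuclideanSpace ℝ (Fin p)) (θ : EuclideanSpace ℝ (Fin q)) : ℝ≥0∞ :=
  G.contextMean
    (fun d => match d.2 with
      | .silent _ => none
      | .challenged x s _ _ =>
        some (pmfKL ((G.gen φ).candidate d.1 x s) (G.genRef.candidate d.1 x s))) φ θ

/-- Generator contexts for KEEP or REVISE: state, proposal, SAC, candidate revision. -/
def klFA (φ : EuclideanSpace ℝ (Fin p)) (θ : EuclideanSpace ℝ (Fin q)) : ℝ≥0∞ :=
  G.contextMean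
    (fun d => match d.2 with
      | .silent _ => none
      | .challenged x s z _ =>
        some (pmfKL ((G.gen φ).respond d.1 x s z) (G.genRef.respond d.1 x s z))) φ θ

/-- The generator's KL-regularized objective `J_f(φ; θ)`. -/
def Jf (φ : EuclideanSpace ℝ (Fin p)) (θ : EuclideanSpace ℝ (Fin q)) : ℝ :=
  G.expectedReward G.rewardF φ θ - G.betaFX * (G.klFX φ θ).toReal
    - G.betaFZ * (G.klFZ φ θ).toReal - G.betaFA * (G.klFA φ θ).toReal

/-- The verifier's KL-regularized objective `J_v(θ; φ)`. -/
def Jv (θ : EuclideanSpace ℝ (Fin q)) (φ : EuclideanSpace ℝ (Fin p)) : ℝ :=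
  G.expectedReward G.rewardV φ θ - G.betaV * (G.klV φ θ).toReal

/-- `∇_φ J_f(φ; θ)`. -/
def gradF (φ : EuclideanSpace ℝ (Fin p)) (θ : EuclideanSpace ℝ (Fin q)) :
    EuclideanSpace ℝ (Fin p) :=
  gradient (fun φ' => G.Jf φ' θ) φ

/-- `∇_θ J_v(θ; φ)`. -/
def gradV (θ : EuclideanSpace ℝ (Fin q)) (φ : EuclideanSpace ℝ (Fin p)) :
    EuclideanSpace ℝ (Fin q) :=
  gradient (fun θ' => G.Jv θ' φ) θ

/-- The game vector field `F(φ, θ) = (∇_φ J_f(φ; θ), ∇_θ J_v(θ; φ))`. -/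
def field (z : EuclideanSpace ℝ (Fin p) × EuclideanSpace ℝ (Fin q)) :
    EuclideanSpace ℝ (Fin p) × EuclideanSpace ℝ (Fin q) :=
  (G.gradF z.1 z.2, G.gradV z.2 z.1)

end GVGame

/-! ### Interpolation, pseudo-trajectories and stability -/

/-- Algorithmic time: the sum of the first `n` step sizes. -/
def algTime (η : ℕ → ℝ) (n : ℕ) : ℝ := ∑ k ∈ Finset.range n, η k

/-- The piecewise linear interpolation of the sequence `x` in algorithmic time: it takes the value
`x n` at `algTime η n` and is affine on `[algTime η n, algTime η (n + 1)]`. -/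
def interpolate {E : Type*} [NormedAddCommGroup E] [NormedSpace ℝ E] (η : ℕ → ℝ) (x : ℕ → E)
    (s : ℝ) : E :=
  let n : ℕ := sSup {n : ℕ | algTime η n ≤ s}
  x n + ((s - algTime η n) / η n) • (x (n + 1) - x n)

/-- `y` solves `y' = F(y)` on the time set `I`. -/
def SolvesODE {E : Type*} [NormedAddCommGroup E] [NormedSpace ℝ E] (F : E → E) (I : Set ℝ)
    (y : ℝ → E) : Prop :=
  ∀ s ∈ I, HasDerivWithinAt y (F (y s)) I s

/-- `X : [0, ∞) → E` is an asymptotic pseudo-trajectory of `y' = F(y)` in the domain `U`: it is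
continuous, and for every `T > 0` the distance between `X (t + s)` and the solution started at
`X t`, at time `s`, tends to `0` as `t → ∞`, uniformly in `0 ≤ s ≤ T`. This includes that for large
`t` the solution exists in `U` up to the time `T`; where `F` is locally Lipschitz on the open set
`U`, it is unique. -/
def IsAsymptoticPseudoTrajectory {E : Type*} [NormedAddCommGroup E] [NormedSpace ℝ E]
    (F : E → E) (U : Set E) (X : ℝ → E) : Prop :=
  ContinuousOn X (Set.Ici 0) ∧
    ∀ T > 0, ∀ ε > 0, ∃ t₀ ≥ 0, ∀ t ≥ t₀, ∃ y : ℝ → E,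
      y 0 = X t ∧ SolvesODE F (Set.Icc 0 T) y ∧
        ∀ s ∈ Set.Icc 0 T, y s ∈ U ∧ dist (X (t + s)) (y s) ≤ ε

/-- `z` is an asymptotically stable point of `y' = F(y)`: it is Lyapunov stable and locally
attracting. It is not presupposed that `F z = 0`. -/
def IsAsymptoticallyStable {E : Type*} [NormedAddCommGroup E] [NormedSpace ℝ E]
    (F : E → E) (z : E) : Prop :=
  (∀ ε > 0, ∃ δ > 0, ∀ x, dist x z < δ → ∃ y : ℝ → E,
    y 0 = x ∧ SolvesODE F (Set.Ici 0) y ∧ ∀ s ≥ 0, dist (y s) z < ε) ∧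
  (∃ δ > 0, ∀ x, dist x z < δ → ∃ y : ℝ → E,
    y 0 = x ∧ SolvesODE F (Set.Ici 0) y ∧ Tendsto y atTop (𝓝 z))

/-- The set of limit points (cluster points as `n → ∞`) of a sequence. -/
def limitPoints {E : Type*} [TopologicalSpace E] (x : ℕ → E) : Set E :=
  {z | MapClusterPt z atTop x}

/-- `z` is an isolated point of `L`. -/
def IsIsolatedIn {E : Type*} [PseudoMetricSpace E] (z : E) (L : Set E) : Prop :=
  z ∈ L ∧ ∃ r > 0, ∀ w ∈ L, dist w z < r → w = z

end

/-! On almost every path the problem is deterministic. The weighted martingale noise has orthogonal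
increments, and `∑ η² < ∞` makes its partial sums an L²-bounded martingale in each coordinate, hence
convergent (`ae_exists_tendsto_sum_smul_noise`). The bias series converges absolutely. The
alternating update evaluates the second component of the field at a point shifted by one increment
of the first player; increments vanish, so this is a drift error tending to `0`.

Tracking (`isAsymptoticPseudoTrajectory_interpolate`): subtracting from the iterates the current
deviation of the perturbation sums from their limit changes them by `o(1)` and removes the noise.
The corrected interpolation then has right derivative `o(1)`-close to the field, and Gronwall's
inequality compares it with a true solution over any horizon `T`.

Limit points: since increments vanish, the iterates cannot keep leaving a neighbourhood of an
isolated limit point without creating another limit point nearby, so they converge to it. A nonzero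
field there would push them at a definite velocity through infinite algorithmic time, contradicting
convergence. The same drift argument for the solution started at a Lyapunov stable point shows that
this point is an equilibrium. -/

/-! ### Ordinary differential equations: extension, existence, stable points. -/

section ODE

variable {E : Type*} [NormedAddCommGroup E] [NormedSpace ℝ E]

open scoped NNReal

/-- The bound is jointly linear in the initial error and the defect. With both equal to `δ`, the
tolerance can be chosen after the growth factor over the horizon is known. -/
theorem gronwallBound_self_eq_mul (δ K x : ℝ) :
    gronwallBound δ K δ x = δ * gronwallBound 1 K 1 x := by
  by_cases hK : K = 0
  · subst hK; simp [gronwallBound_K0]; ring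
  · simp [gronwallBound_of_K_ne_0 hK]; ring

/-- A map that is Lipschitz on a compact set agrees there with a bounded Lipschitz map. -/
theorem LipschitzOnWith.exists_bounded_extension [FiniteDimensional ℝ E] {X : Type*}
    [PseudoMetricSpace X] {f : X → E} {s : Set X} {C : ℝ≥0} (hs : IsCompact s)
    (hf : LipschitzOnWith C f s) :
    ∃ (g : X → E) (L M : ℝ≥0), LipschitzWith L g ∧ (∀ x, ‖g x‖ ≤ M) ∧ Set.EqOn f g s := by
  let e : E ≃L[ℝ] (Fin (Module.finrank ℝ E) → ℝ) :=
    ContinuousLinearEquiv.ofFinrankEq (by simp)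
  obtain ⟨L, hL⟩ : ∃ L, LipschitzOnWith L (fun x => e (f x)) s :=
    ⟨_, e.lipschitz.comp_lipschitzOnWith hf⟩
  obtain ⟨g, hg, hfg⟩ := hL.extend_pi
  obtain ⟨M, hM0, hM⟩ : ∃ M : ℝ, 0 ≤ M ∧ ∀ x ∈ s, ‖g x‖ ≤ M := by
    obtain ⟨M, hM⟩ := hs.exists_bound_of_continuousOn hg.continuous.continuousOn
    exact ⟨max M 0, le_max_right _ _, fun x hx => (hM x hx).trans (le_max_left _ _)⟩
  -- Coordinatewise truncation to `[-M, M]`: nonexpansive for the sup norm, and the identity on the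
  -- values taken on `s`.
  let c : (Fin (Module.finrank ℝ E) → ℝ) → (Fin (Module.finrank ℝ E) → ℝ) :=
    fun v i => max (-M) (min M (v i))
  have hc : LipschitzWith 1 c := by
    refine fun u v => edist_pi_le_iff.2 fun i => ?_
    exact ((LipschitzWith.eval (α := fun _ => ℝ) i).const_min M).const_max (-M) u v
  have hcM : ∀ v, ‖c v‖ ≤ M := fun v => by
    refine (pi_norm_le_iff_of_nonneg hM0).2 fun i => ?_
    rw [Real.norm_eq_abs, abs_le]
    exact ⟨le_max_left _ _, max_le (by linarith) (min_le_left _ _)⟩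
  refine ⟨fun x => e.symm (c (g x)), _,
    ‖(e.symm : (Fin (Module.finrank ℝ E) → ℝ) →L[ℝ] E)‖₊ * M.toNNReal,
    e.symm.lipschitz.comp (hc.comp hg), fun x => ?_, fun x hx => ?_⟩
  · rw [NNReal.coe_mul, Real.coe_toNNReal _ hM0]
    exact (e.symm : (Fin (Module.finrank ℝ E) → ℝ) →L[ℝ] E).le_opNorm_of_le (hcM _)
  · have h1 : c (g x) = e (f x) := by
      rw [show e (f x) = g x from hfg hx]
      funext i
      have h2 := abs_le.1 ((norm_le_pi_norm (g x) i).trans (hM x hx))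
      simp only [c, min_eq_right h2.2, max_eq_right h2.1]
    simp [h1]

/-- A bounded Lipschitz vector field has solutions on every compact time interval. -/
theorem exists_solvesODE_of_bounded_lipschitz [CompleteSpace E] {g : E → E} {L M : ℝ≥0}
    (hg : LipschitzWith L g) (hM : ∀ x, ‖g x‖ ≤ M) {T : ℝ} (hT : 0 ≤ T) (x : E) :
    ∃ y : ℝ → E, y 0 = x ∧ SolvesODE g (Set.Icc 0 T) y := by
  -- At speed at most `M` a solution cannot leave the ball of radius `M * T` within time `T`, so the
  -- local existence theorem covers the whole interval.
  have h : IsPicardLindelof (fun _ => g) (⟨0, le_rfl, hT⟩ : Set.Icc 0 T) x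
      (M * T.toNNReal) 0 M L :=
    { lipschitzOnWith := fun _ _ => hg.lipschitzOnWith
      continuousOn := fun _ _ => continuousOn_const
      norm_le := fun _ _ x _ => hM x
      mul_max_le := by simp [hT] }
  exact h.exists_eq_forall_mem_Icc_hasDerivWithinAt₀

/-- A solution that stays in a ball on which the field deviates from the constant `v` by at most
`‖v‖ / 2` forces `v = 0`. -/
theorem eq_zero_of_solvesODE_of_forall_dist_lt {F : E → E} {z v : E} {ε : ℝ} {y : ℝ → E}
    (hy0 : y 0 = z) (hy : SolvesODE F (Set.Ici 0) y) (hε : ∀ s ≥ 0, dist (y s) z < ε)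
    (hF : ∀ x, dist x z < ε → ‖F x - v‖ ≤ ‖v‖ / 2) : v = 0 := by
  by_contra hv
  have hv' : 0 < ‖v‖ := norm_pos_iff.2 hv
  have key : ∀ s ≥ 0, ‖(y s - s • v) - (y 0 - (0 : ℝ) • v)‖ ≤ ‖v‖ / 2 * ‖s - 0‖ := by
    intro s hs
    refine (convex_Ici (0 : ℝ)).norm_image_sub_le_of_norm_hasDerivWithin_le
      (f := fun s => y s - s • v) (f' := fun s => F (y s) - v) (fun u hu => ?_)
      (fun u hu => hF _ (hε u hu)) (Set.mem_Ici.2 le_rfl) (Set.mem_Ici.2 hs)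
    have h := (hasDerivWithinAt_id u (Set.Ici (0 : ℝ))).smul_const v
    simp only [one_smul] at h
    exact (hy u hu).sub h
  have hεpos : 0 < ε := dist_nonneg.trans_lt (hε 0 le_rfl)
  -- By this time the constant velocity `v` covers the distance `2ε`, and `key` allows a deviation
  -- of at most `ε`; the solution is thus at distance at least `ε` from `z`.
  let s := 2 * ε / ‖v‖
  have hs : 0 ≤ s := by positivity
  have h1 := key s hs
  rw [hy0, zero_smul, sub_zero, sub_zero, Real.norm_of_nonneg hs] at h1
  have h2 : ‖s • v‖ ≤ ‖y s - s • v - z‖ + ‖y s - z‖ := by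
    have h := norm_add_le (-(y s - s • v - z)) (y s - z)
    rwa [norm_neg, show -(y s - s • v - z) + (y s - z) = s • v by abel] at h
  have h3 := hε s hs
  rw [dist_eq_norm] at h3
  rw [norm_smul, Real.norm_of_nonneg hs] at h2
  have h4 : s * ‖v‖ = 2 * ε := by simp only [s]; field_simp
  nlinarith

/-- A Lyapunov stable point at which the field is continuous is an equilibrium. -/
theorem IsAsymptoticallyStable.eq_zero {F : E → E} {z : E} (h : IsAsymptoticallyStable F z)
    (hF : ContinuousAt F z) : F z = 0 := by
  by_contra hv
  have hv' : 0 < ‖F z‖ := norm_pos_iff.2 hv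
  obtain ⟨ε, hε, hε'⟩ := Metric.continuousAt_iff.1 hF (‖F z‖ / 2) (by positivity)
  obtain ⟨δ, hδ, hst⟩ := h.1 ε hε
  obtain ⟨y, hy0, hy, hys⟩ := hst z (by simpa using hδ)
  refine hv (eq_zero_of_solvesODE_of_forall_dist_lt hy0 hy hys fun x hx => ?_)
  rw [← dist_eq_norm]
  exact (hε' hx).le

end ODE

/-! ### Piecewise linear interpolation in algorithmic time. -/

section Interpolation

variable {E : Type*} [NormedAddCommGroup E] [NormedSpace ℝ E]

/-- The index of the step that is running at time `s`. -/
noncomputable def stepIndex (η : ℕ → ℝ) (s : ℝ) : ℕ := sSup {n : ℕ | algTime η n ≤ s}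

variable {η : ℕ → ℝ}

theorem algTime_succ (η : ℕ → ℝ) (n : ℕ) : algTime η (n + 1) = algTime η n + η n :=
  Finset.sum_range_succ _ _

theorem algTime_zero (η : ℕ → ℝ) : algTime η 0 = 0 := Finset.sum_range_zero _

theorem algTime_strictMono (hη : ∀ t, 0 < η t) : StrictMono (algTime η) :=
  strictMono_nat_of_lt_succ fun n => by rw [algTime_succ]; linarith [hη n]

theorem tendsto_algTime (hη : ∀ t, 0 < η t) (hη_sum : ¬ Summable η) :
    Tendsto (algTime η) atTop atTop :=
  (not_summable_iff_tendsto_nat_atTop_of_nonneg fun n => (hη n).le).1 hη_sum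

theorem stepIndex_eq (hη : ∀ t, 0 < η t) {s : ℝ} {n : ℕ} (h1 : algTime η n ≤ s)
    (h2 : s < algTime η (n + 1)) : stepIndex η s = n := by
  have h : {k : ℕ | algTime η k ≤ s} = Set.Iic n := by
    ext k
    simp only [Set.mem_ofPred_eq, Set.mem_Iic]
    refine ⟨fun hk => ?_, fun hk => ((algTime_strictMono hη).monotone hk).trans h1⟩
    exact Nat.lt_succ_iff.1 ((algTime_strictMono hη).lt_iff_lt.1 (hk.trans_lt h2))
  rw [stepIndex, h, csSup_Iic]

theorem exists_algTime_le_lt (hη : ∀ t, 0 < η t) (hη_sum : ¬ Summable η) {s : ℝ} (hs : 0 ≤ s) :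
    ∃ n, algTime η n ≤ s ∧ s < algTime η (n + 1) := by
  classical
  have hex : ∃ n, s < algTime η n := ((tendsto_algTime hη hη_sum).eventually_gt_atTop s).exists
  have h0 : Nat.find hex ≠ 0 := fun h => by
    have := Nat.find_spec hex
    rw [h, algTime_zero] at this
    linarith
  obtain ⟨n, hn⟩ := Nat.exists_eq_succ_of_ne_zero h0
  refine ⟨n, not_lt.1 (Nat.find_min hex (by omega)), ?_⟩
  have := Nat.find_spec hex
  rwa [hn] at this

theorem stepIndex_spec (hη : ∀ t, 0 < η t) (hη_sum : ¬ Summable η) {s : ℝ} (hs : 0 ≤ s) :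
    algTime η (stepIndex η s) ≤ s ∧ s < algTime η (stepIndex η s + 1) := by
  obtain ⟨n, h1, h2⟩ := exists_algTime_le_lt hη hη_sum hs
  rw [stepIndex_eq hη h1 h2]
  exact ⟨h1, h2⟩

theorem tendsto_stepIndex (hη : ∀ t, 0 < η t) (hη_sum : ¬ Summable η) :
    Tendsto (stepIndex η) atTop atTop := by
  refine tendsto_atTop.2 fun n => ?_
  filter_upwards [eventually_ge_atTop (algTime η n), eventually_ge_atTop 0] with s hs hs0
  have := (stepIndex_spec hη hη_sum hs0).2
  exact Nat.lt_succ_iff.1 ((algTime_strictMono hη).lt_iff_lt.1 (hs.trans_lt this))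

theorem interpolate_eq_stepIndex (η : ℕ → ℝ) (x : ℕ → E) (s : ℝ) :
    interpolate η x s = x (stepIndex η s) +
      ((s - algTime η (stepIndex η s)) / η (stepIndex η s)) •
        (x (stepIndex η s + 1) - x (stepIndex η s)) := rfl

theorem interpolate_sub (η : ℕ → ℝ) (x y : ℕ → E) (s : ℝ) :
    interpolate η (fun n => x n - y n) s = interpolate η x s - interpolate η y s := by
  simp only [interpolate_eq_stepIndex, smul_sub]
  abel

theorem norm_interpolate_sub_le (hη : ∀ t, 0 < η t) (hη_sum : ¬ Summable η) (x : ℕ → E) {s : ℝ}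
    (hs : 0 ≤ s) :
    ‖interpolate η x s - x (stepIndex η s)‖ ≤ ‖x (stepIndex η s + 1) - x (stepIndex η s)‖ := by
  obtain ⟨h1, h2⟩ := stepIndex_spec hη hη_sum hs
  rw [interpolate_eq_stepIndex, add_sub_cancel_left, norm_smul]
  refine mul_le_of_le_one_left (norm_nonneg _) ?_
  have := hη (stepIndex η s)
  rw [algTime_succ] at h2
  rw [Real.norm_of_nonneg (div_nonneg (by linarith) this.le), div_le_one this]
  linarith

/-- At the right endpoint `stepIndex` has already jumped to `n + 1`, but both affine formulas give
`x (n + 1)`. Including this endpoint is what yields continuity from the left. -/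
theorem interpolate_eq_of_mem_Icc (hη : ∀ t, 0 < η t) (x : ℕ → E) {s : ℝ} {n : ℕ}
    (h1 : algTime η n ≤ s) (h2 : s ≤ algTime η (n + 1)) :
    interpolate η x s = x n + ((s - algTime η n) / η n) • (x (n + 1) - x n) := by
  rcases h2.lt_or_eq with h2 | rfl
  · rw [interpolate_eq_stepIndex, stepIndex_eq hη h1 h2]
  · have h3 : stepIndex η (algTime η (n + 1)) = n + 1 :=
      stepIndex_eq hη le_rfl (algTime_strictMono hη (Nat.lt_succ_self _))
    rw [interpolate_eq_stepIndex, h3, algTime_succ η n]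
    simp [(hη n).ne']

/-- The step index is constant just to the right of every time, nodes included. One-sided
derivatives are all that Gronwall's inequality requires. -/
theorem hasDerivWithinAt_interpolate (hη : ∀ t, 0 < η t) (hη_sum : ¬ Summable η) (x : ℕ → E)
    {s : ℝ} (hs : 0 ≤ s) :
    HasDerivWithinAt (interpolate η x)
      ((η (stepIndex η s))⁻¹ • (x (stepIndex η s + 1) - x (stepIndex η s))) (Set.Ici s) s := by
  obtain ⟨h1, h2⟩ := stepIndex_spec hη hη_sum hs
  set n := stepIndex η s
  have h3 : HasDerivAt (fun u => x n + ((u - algTime η n) / η n) • (x (n + 1) - x n))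
      ((η n)⁻¹ • (x (n + 1) - x n)) s := by
    have := ((((hasDerivAt_id s).sub_const (algTime η n)).div_const (η n)).smul_const
      (x (n + 1) - x n)).const_add (x n)
    simpa [one_div] using this
  refine h3.hasDerivWithinAt.congr_of_eventuallyEq ?_
    (interpolate_eq_of_mem_Icc hη x h1 h2.le)
  filter_upwards [Ico_mem_nhdsGE h2] with u hu
  exact interpolate_eq_of_mem_Icc hη x (h1.trans hu.1) hu.2.le

theorem continuousOn_interpolate (hη : ∀ t, 0 < η t) (hη_sum : ¬ Summable η) (x : ℕ → E) :
    ContinuousOn (interpolate η x) (Set.Ici 0) := by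
  intro s hs
  have hr := (hasDerivWithinAt_interpolate hη hη_sum x hs).continuousWithinAt
  rcases (Set.mem_Ici.1 hs).eq_or_lt with rfl | hs'
  · exact hr
  refine ContinuousAt.continuousWithinAt (continuousAt_iff_continuous_left_right.2 ⟨?_, hr⟩)
  -- A step that begins strictly before `s`: at a node it is the preceding one, which exists because
  -- `s > 0`.
  obtain ⟨n, h1, h2⟩ : ∃ n, algTime η n < s ∧ s ≤ algTime η (n + 1) := by
    obtain ⟨h1, h2⟩ := stepIndex_spec hη hη_sum hs'.le
    rcases h1.lt_or_eq with h1 | h1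
    · exact ⟨_, h1, h2.le⟩
    · obtain ⟨k, hk⟩ := Nat.exists_eq_succ_of_ne_zero (n := stepIndex η s) fun h => by
        rw [h, algTime_zero] at h1
        exact hs'.ne h1
      rw [hk] at h1
      exact ⟨k, h1 ▸ algTime_strictMono hη (Nat.lt_succ_self _), h1.ge⟩
  have h3 : ContinuousAt (fun u => x n + ((u - algTime η n) / η n) • (x (n + 1) - x n)) s := by
    fun_prop
  refine h3.continuousWithinAt.congr_of_eventuallyEq ?_ (interpolate_eq_of_mem_Icc hη x h1.le h2)
  filter_upwards [Ioc_mem_nhdsLE h1] with u hu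
  exact interpolate_eq_of_mem_Icc hη x hu.1.le (hu.2.trans h2)

end Interpolation

/-! ### Perturbed Euler schemes: tracking and limit points. -/

section StochasticApproximation

variable {E : Type*} [NormedAddCommGroup E] [NormedSpace ℝ E]

open scoped NNReal

/-- The increments of a perturbed Euler scheme with bounded drift tend to `0`. -/
theorem tendsto_increment_zero {M : ℝ} {η : ℕ → ℝ} (hη0 : Tendsto η atTop (𝓝 0))
    {z u a d : ℕ → E} (hu : ∀ n, ‖u n‖ ≤ M)
    (hrec : ∀ n, z (n + 1) = z n + η n • (u n + d n) + a n)
    (hd : Tendsto d atTop (𝓝 0)) (ha : Tendsto a atTop (𝓝 0)) :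
    Tendsto (fun n => z (n + 1) - z n) atTop (𝓝 0) := by
  have h1 : Tendsto (fun n => η n • u n) atTop (𝓝 0) :=
    hη0.zero_smul_isBoundedUnder_le (isBoundedUnder_of ⟨M, hu⟩)
  have h2 := (h1.add (hη0.smul hd)).add ha
  simp only [smul_zero, add_zero] at h2
  refine h2.congr fun n => ?_
  rw [hrec, smul_add]
  abel

omit [NormedSpace ℝ E] in
theorem tendsto_zero_of_tendsto_sum {a : ℕ → E} {l : E}
    (ha : Tendsto (fun n => ∑ k ∈ Finset.range n, a k) atTop (𝓝 l)) :
    Tendsto a atTop (𝓝 0) := by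
  have h := ((tendsto_add_atTop_iff_nat 1).2 ha).sub ha
  rw [sub_self] at h
  exact h.congr fun n => by rw [Finset.sum_range_succ, add_sub_cancel_left]

/-- A perturbed Euler scheme in a compact set, with perturbations `a` whose series converges and
`η • d` with `d → 0`, interpolates to an asymptotic pseudo-trajectory. -/
theorem isAsymptoticPseudoTrajectory_interpolate [FiniteDimensional ℝ E] {F : E → E}
    {U K : Set E} (hU : IsOpen U) (hK : IsCompact K) (hKU : K ⊆ U) (hF : LocallyLipschitzOn U F)
    {η : ℕ → ℝ} (hη : ∀ t, 0 < η t) (hη_sum : ¬ Summable η) (hη0 : Tendsto η atTop (𝓝 0))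
    {z a d : ℕ → E} (hz : ∀ n, z n ∈ K)
    (hrec : ∀ n, z (n + 1) = z n + η n • (F (z n) + d n) + a n)
    (hd : Tendsto d atTop (𝓝 0)) {l : E}
    (ha : Tendsto (fun n => ∑ k ∈ Finset.range n, a k) atTop (𝓝 l)) :
    IsAsymptoticPseudoTrajectory F U (interpolate η z) := by
  refine ⟨continuousOn_interpolate hη hη_sum z, ?_⟩
  intro T hT ε hε
  have : ProperSpace E := FiniteDimensional.proper ℝ E
  have : CompleteSpace E := FiniteDimensional.complete ℝ E
  obtain ⟨r, hr, hrU⟩ := hK.exists_cthickening_subset_open hU hKU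
  have hK' : IsCompact (Metric.cthickening r K) := hK.cthickening
  obtain ⟨C, hC⟩ := (hF.mono hrU).exists_lipschitzOnWith_of_compact hK'
  -- The global field `g` gives a solution up to time `T` before it is known to stay near `K`. It
  -- can also be evaluated at interpolated points, which may leave `K` since `K` need not be convex.
  obtain ⟨g, L, M, hgL, hgM, hgF⟩ := hC.exists_bounded_extension hK'
  have hKr : K ⊆ Metric.cthickening r K := Metric.self_subset_cthickening K
  obtain ⟨M', hM'⟩ := hK.exists_bound_of_continuousOn (hC.continuousOn.mono hKr)
  have hdz := tendsto_increment_zero hη0 (fun n => hM' _ (hz n)) hrec hd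
    (tendsto_zero_of_tendsto_sum ha)
  -- Minus the tail of the convergent series. Subtracting it leaves increments driven only by `η •
  -- (F + d)`.
  set N : ℕ → E := fun n => ∑ k ∈ Finset.range n, a k - l with hN
  have hN0 : Tendsto N atTop (𝓝 0) := by simpa [hN] using ha.sub_const l
  set w : ℕ → E := fun n => z n - N n with hw
  have hwrec : ∀ n, w (n + 1) - w n = η n • (F (z n) + d n) := fun n => by
    simp only [hw, hN, hrec n, Finset.sum_range_succ]
    abel
  have hdw : Tendsto (fun n => w (n + 1) - w n) atTop (𝓝 0) := by
    have h := hdz.sub (((tendsto_add_atTop_iff_nat 1).2 hN0).sub hN0)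
    simp only [sub_zero] at h
    refine h.congr fun n => ?_
    simp only [hw]
    abel
  -- One radius for both demands: accuracy `ε`, and confinement to the tube on which `g = F`.
  set ρ := min ε r with hρ
  have hρ0 : 0 < ρ := lt_min hε hr
  set B := gronwallBound 1 L 1 T with hB
  have hB1 : 1 ≤ B := by
    have := gronwallBound_mono zero_le_one zero_le_one L.2 hT.le
    rwa [gronwallBound_x0] at this
  set δ := ρ / (4 * B) with hδ
  have hδ0 : 0 < δ := by positivity
  have hδB : δ * B = ρ / 4 := by rw [hδ]; field_simp
  have hδρ : δ ≤ ρ / 4 := hδB ▸ le_mul_of_one_le_right hδ0.le hB1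
  have hidx := tendsto_stepIndex hη hη_sum
  -- uniform smallness of all the errors after some time
  have hev : ∀ᶠ s in atTop, 0 ≤ s ∧ ‖z (stepIndex η s + 1) - z (stepIndex η s)‖ ≤ ρ / 4 ∧
      ‖interpolate η z s - interpolate η w s‖ ≤ δ ∧
      ‖F (z (stepIndex η s)) + d (stepIndex η s) - g (interpolate η w s)‖ ≤ δ := by
    have e1 : Tendsto (fun n => ‖N n‖ + ‖N (n + 1) - N n‖) atTop (𝓝 0) := by
      simpa using hN0.norm.add ((((tendsto_add_atTop_iff_nat 1).2 hN0).sub hN0).norm)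
    have e2 : Tendsto (fun n => ‖d n‖ + L * (‖N n‖ + ‖w (n + 1) - w n‖)) atTop (𝓝 0) := by
      simpa using hd.norm.add ((hN0.norm.add hdw.norm).const_mul (L : ℝ))
    have e3 : Tendsto (fun n => ‖z (n + 1) - z n‖) atTop (𝓝 0) := by simpa using hdz.norm
    filter_upwards [eventually_ge_atTop 0,
      (e3.comp hidx).eventually_le_const (show 0 < ρ / 4 by positivity),
      (e1.comp hidx).eventually_le_const hδ0, (e2.comp hidx).eventually_le_const hδ0]
      with s h0 h3 h1 h2
    simp only [Function.comp_apply] at h1 h2 h3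
    refine ⟨h0, h3, ?_, ?_⟩
    · have hXW : interpolate η z s - interpolate η w s = interpolate η N s := by
        rw [← interpolate_sub]
        simp [hw]
      rw [hXW]
      have := norm_interpolate_sub_le hη hη_sum N h0
      linarith [norm_le_norm_add_norm_sub' (interpolate η N s) (N (stepIndex η s))]
    · have hzw : ‖z (stepIndex η s) - interpolate η w s‖ ≤
          ‖N (stepIndex η s)‖ + ‖w (stepIndex η s + 1) - w (stepIndex η s)‖ := by
        have h4 : z (stepIndex η s) - interpolate η w s =
            N (stepIndex η s) - (interpolate η w s - w (stepIndex η s)) := by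
          simp only [hw]
          abel
        rw [h4]
        exact (norm_sub_le _ _).trans
          (add_le_add_right (norm_interpolate_sub_le hη hη_sum w h0) _)
      have h5 : ‖g (z (stepIndex η s)) - g (interpolate η w s)‖ ≤
          L * ‖z (stepIndex η s) - interpolate η w s‖ := by
        simpa only [dist_eq_norm] using hgL.dist_le_mul (z (stepIndex η s)) (interpolate η w s)
      rw [show F (z (stepIndex η s)) = g (z (stepIndex η s)) from hgF (hKr (hz _)),
        add_sub_right_comm]
      refine (norm_add_le _ _).trans ?_
      have h6 := mul_le_mul_of_nonneg_left hzw L.coe_nonneg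
      linarith
  obtain ⟨t₀, ht₀⟩ := eventually_atTop.1 hev
  refine ⟨max t₀ 0, le_max_right _ _, fun t ht => ?_⟩
  have htt : t₀ ≤ t := (le_max_left _ _).trans ht
  obtain ⟨y, hy0, hy⟩ := exists_solvesODE_of_bounded_lipschitz hgL hgM hT.le (interpolate η z t)
  have hgron : ∀ s ∈ Set.Icc 0 T, dist (interpolate η w (t + s)) (y s) ≤ ρ / 4 := by
    intro s hs
    have hder : ∀ u ∈ Set.Ico 0 T, HasDerivWithinAt (fun u => interpolate η w (t + u))
        (F (z (stepIndex η (t + u))) + d (stepIndex η (t + u))) (Set.Ici u) u := by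
      intro u hu
      have h1 := hasDerivWithinAt_interpolate hη hη_sum w
        (ht₀ (t + u) (by linarith [hu.1])).1
      rw [hwrec, smul_smul, inv_mul_cancel₀ (hη _).ne', one_smul] at h1
      have h2 := h1.scomp u ((hasDerivWithinAt_id u (Set.Ici u)).const_add t)
        (fun v hv => by simpa using hv)
      simpa [Function.comp_def] using h2
    have h := dist_le_of_approx_trajectories_ODE (v := fun _ => g) (K := L) (a := 0) (b := T)
      (f := fun u => interpolate η w (t + u)) (g := y) (g' := fun u => g (y u))
      (εf := δ) (εg := 0) (δ := δ) (fun _ => hgL)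
      ((continuousOn_interpolate hη hη_sum w).comp (by fun_prop) fun u hu => by
        have := (ht₀ t htt).1
        exact Set.mem_Ici.2 (by linarith [hu.1]))
      hder (fun u hu => by
        rw [dist_eq_norm]
        exact (ht₀ (t + u) (by linarith [hu.1])).2.2.2)
      (fun u hu => (hy u hu).continuousWithinAt)
      (fun u hu => (hy u (Set.Ico_subset_Icc_self hu)).mono_of_mem_nhdsWithin
        (Icc_mem_nhdsGE_of_mem hu))
      (fun u hu => (dist_self _).le)
      (by
        rw [add_zero, hy0, dist_comm, dist_eq_norm]
        exact (ht₀ t htt).2.2.1) s hs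
    refine h.trans ?_
    rw [add_zero, sub_zero, gronwallBound_self_eq_mul, ← hδB]
    exact mul_le_mul_of_nonneg_left (gronwallBound_mono zero_le_one zero_le_one L.2 hs.2) hδ0.le
  have hXy : ∀ s ∈ Set.Icc 0 T, dist (interpolate η z (t + s)) (y s) ≤ ρ / 2 := by
    intro s hs
    have h1 := (ht₀ (t + s) (by linarith [hs.1])).2.2.1
    rw [← dist_eq_norm] at h1
    linarith [dist_triangle (interpolate η z (t + s)) (interpolate η w (t + s)) (y s),
      hgron s hs]
  -- This closes the argument: `y` is within `ρ / 2` of the interpolation, which is within `ρ / 4`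
  -- of an iterate in `K`. So `y` stays in the tube and solves the equation for `F` itself.
  have hyK : ∀ s ∈ Set.Icc 0 T, y s ∈ Metric.cthickening r K := by
    intro s hs
    obtain ⟨h0, h1, -⟩ := ht₀ (t + s) (by linarith [hs.1])
    refine Metric.mem_cthickening_of_dist_le _ _ _ _ (hz (stepIndex η (t + s))) ?_
    have h2 := norm_interpolate_sub_le hη hη_sum z h0
    rw [← dist_eq_norm] at h2
    have h3 := hXy s hs
    rw [dist_comm] at h3
    have h4 : ρ ≤ r := min_le_right _ _
    linarith [dist_triangle (y s) (interpolate η z (t + s)) (z (stepIndex η (t + s)))]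
  refine ⟨y, hy0, fun s hs => ?_, fun s hs => ⟨hrU (hyK s hs), (hXy s hs).trans ?_⟩⟩
  · rw [show F (y s) = g (y s) from hgF (hyK s hs)]
    exact hy s hs
  · have h4 : ρ ≤ ε := min_le_left _ _
    linarith

omit [NormedSpace ℝ E] in
/-- A sequence in a compact set whose increments tend to `0` converges to each isolated point of
its set of limit points. -/
theorem IsIsolatedIn.tendsto_of_increment {z : ℕ → E} {K : Set E} (hK : IsCompact K)
    (hz : ∀ n, z n ∈ K) (hdz : Tendsto (fun n => z (n + 1) - z n) atTop (𝓝 0)) {x : E}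
    (hx : IsIsolatedIn x (limitPoints z)) : Tendsto z atTop (𝓝 x) := by
  obtain ⟨hxl, r, hr, hiso⟩ := hx
  refine Metric.tendsto_atTop.2 fun ε hε => ?_
  by_contra! hcon
  set ρ := min ε (r / 2) with hρ
  have hρ0 : 0 < ρ := lt_min hε (by positivity)
  obtain ⟨n₀, hn₀⟩ := Metric.tendsto_atTop.1 hdz (ρ / 2) (by positivity)
  -- Each excursion starts inside radius `ρ / 2`, and eventually increments are shorter than `ρ /
  -- 2`, so its first exit lands in the annulus. Compactness then gives a limit point there, within
  -- `r` of `x` but different from it.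
  have hfreq : ∃ᶠ n in atTop, z n ∈ K ∩ {w | ρ / 2 ≤ dist w x ∧ dist w x ≤ ρ} := by
    refine frequently_atTop.2 fun n₁ => ?_
    obtain ⟨n, hn, hnx⟩ := frequently_atTop.1
      (hxl.frequently (Metric.ball_mem_nhds x (show 0 < ρ / 2 by positivity))) (max n₀ n₁)
    obtain ⟨m', hm', hmx'⟩ := hcon n
    classical
    have hex : ∃ m, n ≤ m ∧ ρ / 2 ≤ dist (z m) x :=
      ⟨m', hm', by linarith [min_le_left ε (r / 2)]⟩
    obtain ⟨h1, h2⟩ := Nat.find_spec hex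
    have h3 : n < Nat.find hex := lt_of_le_of_ne h1 fun h => by
      rw [← h] at h2
      exact (Metric.mem_ball.1 hnx).not_ge h2
    obtain ⟨k, hk⟩ := Nat.exists_eq_succ_of_ne_zero (n := Nat.find hex) (by omega)
    have h4 := Nat.find_min hex (m := k) (by omega)
    have h5 : dist (z k) x < ρ / 2 := by
      by_contra! h
      exact h4 ⟨by omega, h⟩
    have hnn := (le_max_left n₀ n₁).trans hn
    have hnn' := (le_max_right n₀ n₁).trans hn
    have h6 := hn₀ k (by omega)
    rw [dist_zero_right, ← dist_eq_norm] at h6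
    refine ⟨Nat.find hex, by omega, hz _, h2, ?_⟩
    rw [hk, Nat.succ_eq_add_one]
    linarith [dist_triangle (z (k + 1)) (z k) x]
  have hcomp : IsCompact (K ∩ {w | ρ / 2 ≤ dist w x ∧ dist w x ≤ ρ}) := by
    have hcl : IsClosed ((fun w => dist w x) ⁻¹' Set.Icc (ρ / 2) ρ) :=
      isClosed_Icc.preimage (by fun_prop)
    exact hK.inter_right hcl
  obtain ⟨w, hw, hwc⟩ := hcomp.exists_mapClusterPt_of_frequently hfreq
  have h7 : ρ ≤ r / 2 := min_le_right _ _
  have h8 := hiso w hwc (by linarith [hw.2.2])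
  have h9 := hw.2.1
  rw [h8, dist_self] at h9
  linarith

/-- If a perturbed Euler scheme converges to a point at which the field is continuous, then the
field vanishes there. -/
theorem eq_zero_of_tendsto_euler {F : E → E} {η : ℕ → ℝ} (hη : ∀ t, 0 < η t)
    (hη_sum : ¬ Summable η) {z a d : ℕ → E}
    (hrec : ∀ n, z (n + 1) = z n + η n • (F (z n) + d n) + a n)
    (hd : Tendsto d atTop (𝓝 0)) {l : E}
    (ha : Tendsto (fun n => ∑ k ∈ Finset.range n, a k) atTop (𝓝 l)) {x : E}
    (hzx : Tendsto z atTop (𝓝 x)) (hF : Tendsto (fun n => F (z n)) atTop (𝓝 (F x))) :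
    F x = 0 := by
  by_contra hv
  have hv' : 0 < ‖F x‖ := norm_pos_iff.2 hv
  set w : ℕ → E := fun n => z n - ∑ k ∈ Finset.range n, a k with hw
  have hwl : Tendsto w atTop (𝓝 (x - l)) := hzx.sub ha
  have hwrec : ∀ n, w (n + 1) - w n = η n • (F (z n) + d n) := fun n => by
    simp only [hw, hrec n, Finset.sum_range_succ]
    abel
  have hG : Tendsto (fun n => F (z n) + d n) atTop (𝓝 (F x)) := by simpa using hF.add hd
  obtain ⟨n₀, hn₀⟩ := Metric.tendsto_atTop.1 hG (‖F x‖ / 2) (by positivity)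
  -- The displacement of `w` differs from elapsed time times `F x` by at most half the latter's
  -- norm. It therefore grows without bound, although `w` converges.
  have key : ∀ m, (algTime η (n₀ + m) - algTime η n₀) * (‖F x‖ / 2) ≤ ‖w (n₀ + m) - w n₀‖ := by
    intro m
    have h1 : ‖w (n₀ + m) - w n₀ - (algTime η (n₀ + m) - algTime η n₀) • F x‖ ≤
        (algTime η (n₀ + m) - algTime η n₀) * (‖F x‖ / 2) := by
      induction m with
      | zero => simp
      | succ m ih =>
        have h2 : w (n₀ + (m + 1)) - w n₀ - (algTime η (n₀ + (m + 1)) - algTime η n₀) • F x =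
            (w (n₀ + m) - w n₀ - (algTime η (n₀ + m) - algTime η n₀) • F x) +
              η (n₀ + m) • (F (z (n₀ + m)) + d (n₀ + m) - F x) := by
          rw [smul_sub, ← hwrec, ← add_assoc, algTime_succ]
          module
        have h3 := (hn₀ (n₀ + m) (by omega)).le
        rw [dist_eq_norm] at h3
        rw [h2, ← add_assoc, algTime_succ]
        refine (norm_add_le _ _).trans ?_
        rw [norm_smul, Real.norm_of_nonneg (hη _).le]
        have := mul_le_mul_of_nonneg_left h3 (hη (n₀ + m)).le
        linarith
    have h4 : 0 ≤ algTime η (n₀ + m) - algTime η n₀ :=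
      sub_nonneg.2 ((algTime_strictMono hη).monotone (by omega))
    have h5 := norm_sub_norm_le ((algTime η (n₀ + m) - algTime η n₀) • F x) (w (n₀ + m) - w n₀)
    rw [norm_sub_rev _ (w (n₀ + m) - w n₀), norm_smul, Real.norm_of_nonneg h4] at h5
    linarith
  have hbig : Tendsto (fun m => (algTime η (n₀ + m) - algTime η n₀) * (‖F x‖ / 2)) atTop atTop := by
    refine Tendsto.atTop_mul_const (by positivity) (tendsto_atTop_add_const_right _ _ ?_)
    simpa only [add_comm n₀] using (tendsto_add_atTop_iff_nat n₀).2 (tendsto_algTime hη hη_sum)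
  have hlim : Tendsto (fun m => ‖w (n₀ + m) - w n₀‖) atTop (𝓝 ‖x - l - w n₀‖) := by
    have := (((tendsto_add_atTop_iff_nat n₀).2 hwl).sub_const (w n₀)).norm
    simpa only [add_comm n₀] using this
  exact not_tendsto_atTop_of_tendsto_nhds hlim (tendsto_atTop_mono key hbig)

end StochasticApproximation

/-! ### Almost sure convergence of the martingale noise. -/

section MartingaleNoise

variable {Ω : Type*} {mΩ : MeasurableSpace Ω} {P : Measure Ω} [IsProbabilityMeasure P]

/-- A series of real martingale differences with summable variances converges almost surely. -/
theorem ae_exists_tendsto_sum_of_martingale_difference (ℱ : Filtration ℕ mΩ) {X : ℕ → Ω → ℝ}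
    (hX : ∀ t, StronglyMeasurable[ℱ (t + 1)] (X t)) (hX2 : ∀ t, MemLp (X t) 2 P)
    (hcond : ∀ t, P[X t | ℱ t] =ᵐ[P] 0) {v : ℕ → ℝ} (hv : Summable v)
    (hXv : ∀ t, ∫ ω, X t ω ^ 2 ∂P ≤ v t) :
    ∀ᵐ ω ∂P, ∃ l, Tendsto (fun n => ∑ k ∈ Finset.range n, X k ω) atTop (𝓝 l) := by
  set S : ℕ → Ω → ℝ := fun n ω => ∑ k ∈ Finset.range n, X k ω with hS
  have hS_succ : ∀ n, S (n + 1) = S n + X n := fun n => by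
    funext ω
    simp [hS, Finset.sum_range_succ]
  have hSm : StronglyAdapted ℱ S := fun n =>
    Finset.stronglyMeasurable_fun_sum _ fun k hk =>
      (hX k).mono (ℱ.mono (Nat.succ_le_of_lt (Finset.mem_range.1 hk)))
  have hS2 : ∀ n, MemLp (S n) 2 P := fun n => memLp_finsetSum _ fun k _ => hX2 k
  have hmart : Martingale S ℱ P := by
    refine martingale_of_condExp_sub_eq_zero_nat hSm (fun n => (hS2 n).integrable one_le_two)
      fun n => ?_
    rw [hS_succ, add_sub_cancel_left]
    exact hcond n
  -- `S n` is known at time `n`, so it factors out of the conditional expectation of the product.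
  have horth : ∀ n, ∫ ω, S n ω * X n ω ∂P = 0 := fun n => by
    have hint : Integrable (S n * X n) P := (hS2 n).integrable_mul (hX2 n)
    have h1 := condExp_mul_of_stronglyMeasurable_left (hSm n) hint
      ((hX2 n).integrable one_le_two)
    have h2 : P[S n * X n | ℱ n] =ᵐ[P] 0 := by
      filter_upwards [h1, hcond n] with ω h3 h4
      simp [h3, h4]
    have h3 := integral_condExp (μ := P) (ℱ.le n) (f := S n * X n)
    rw [integral_congr_ae h2] at h3
    simpa using h3.symm
  have hsq : ∀ n, ∫ ω, S n ω ^ 2 ∂P ≤ ∑ k ∈ Finset.range n, v k := fun n => by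
    induction n with
    | zero => simp [hS]
    | succ n ih =>
      have h1 : ∀ ω, S (n + 1) ω ^ 2 = S n ω ^ 2 + 2 * (S n ω * X n ω) + X n ω ^ 2 := fun ω => by
        rw [hS_succ, Pi.add_apply]
        ring
      have i1 : Integrable (fun ω => S n ω ^ 2) P := (hS2 n).integrable_sq
      have i2 : Integrable (fun ω => 2 * (S n ω * X n ω)) P :=
        ((hS2 n).integrable_mul (hX2 n)).const_mul 2
      have i3 : Integrable (fun ω => X n ω ^ 2) P := (hX2 n).integrable_sq
      have i12 : Integrable (fun ω => S n ω ^ 2 + 2 * (S n ω * X n ω)) P := i1.add i2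
      simp only [h1]
      rw [integral_add i12 i3, integral_add i1 i2, integral_const_mul, horth,
        Finset.sum_range_succ]
      linarith [hXv n]
  have hv0 : ∀ t, 0 ≤ v t := fun t => (integral_nonneg fun ω => sq_nonneg _).trans (hXv t)
  -- Martingale convergence needs a uniform L¹ bound; `|x| ≤ 1 + x²` derives it from the second
  -- moments.
  have hbdd : ∀ n, eLpNorm (S n) 1 P ≤ (Real.toNNReal (1 + ∑' k, v k) : ℝ≥0∞) := fun n => by
    have hi : Integrable (S n) P := (hS2 n).integrable one_le_two
    rw [eLpNorm_one_eq_lintegral_enorm, ← ofReal_integral_norm_eq_lintegral_enorm hi]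
    refine ENNReal.ofReal_le_ofReal ?_
    have h1 : ∫ ω, ‖S n ω‖ ∂P ≤ ∫ ω, (1 + S n ω ^ 2) ∂P := by
      refine integral_mono hi.norm ((integrable_const 1).add (hS2 n).integrable_sq) fun ω => ?_
      simp only [Real.norm_eq_abs]
      nlinarith [sq_nonneg (|S n ω| - 1), sq_abs (S n ω), abs_nonneg (S n ω)]
    rw [integral_add (integrable_const 1) (hS2 n).integrable_sq] at h1
    have h2 := (hsq n).trans (hv.sum_le_tsum _ fun k _ => hv0 k)
    simp only [integral_const, probReal_univ, smul_eq_mul, mul_one] at h1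
    linarith
  filter_upwards [hmart.submartingale.ae_tendsto_limitProcess hbdd] with ω hω
  exact ⟨_, hω⟩

/-- With square-summable step sizes, the accumulated martingale-difference noise with bounded
second moments converges almost surely. -/
theorem ae_exists_tendsto_sum_smul_noise {d : ℕ} (ℱ : Filtration ℕ mΩ) {η : ℕ → ℝ}
    (hη_sq : Summable fun t => η t ^ 2) {M : ℕ → Ω → EuclideanSpace ℝ (Fin d)}
    (hM : ∀ t, StronglyMeasurable[ℱ (t + 1)] (M t)) (hM2 : ∀ t, MemLp (M t) 2 P) {C : ℝ}
    (hC : ∀ t, ∫ ω, ‖M t ω‖ ^ 2 ∂P ≤ C) (hcond : ∀ t, P[M t | ℱ t] =ᵐ[P] 0) :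
    ∀ᵐ ω ∂P, ∃ l, Tendsto (fun n => ∑ k ∈ Finset.range n, η k • M k ω) atTop (𝓝 l) := by
  have hcoord : ∀ᵐ ω ∂P, ∀ i, ∃ l,
      Tendsto (fun n => ∑ k ∈ Finset.range n, η k * M k ω i) atTop (𝓝 l) := by
    refine ae_all_iff.2 fun i => ?_
    let π : EuclideanSpace ℝ (Fin d) →L[ℝ] ℝ := EuclideanSpace.proj i
    refine ae_exists_tendsto_sum_of_martingale_difference (X := fun t ω => η t * M t ω i) ℱ
      (fun t => ?_) (fun t => ?_) (fun t => ?_) (hη_sq.mul_right C) fun t => ?_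
    · exact (π.continuous.comp_stronglyMeasurable (hM t)).const_mul (η t)
    · exact (π.comp_memLp' (hM2 t)).const_mul (η t)
    · have h1 := (η t • π).comp_condExp_comm (m := ℱ t) ((hM2 t).integrable one_le_two)
      filter_upwards [h1, hcond t] with ω h2 h3
      simp only [Function.comp_apply, h3, Pi.zero_apply, map_zero] at h2
      exact h2.symm
    · have hi : Integrable (fun ω => ‖M t ω‖ ^ 2) P := (hM2 t).integrable_norm_pow (by norm_num)
      simp only [mul_pow, integral_const_mul]
      refine mul_le_mul_of_nonneg_left (le_trans ?_ (hC t)) (sq_nonneg _)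
      refine integral_mono (π.comp_memLp' (hM2 t)).integrable_sq hi fun ω => ?_
      have h1 : ‖M t ω i‖ ≤ ‖M t ω‖ := PiLp.norm_apply_le (M t ω) i
      have h2 := pow_le_pow_left₀ (norm_nonneg _) h1 2
      simpa [Real.norm_eq_abs, sq_abs] using h2
  filter_upwards [hcoord] with ω hω
  choose l hl using hω
  refine ⟨WithLp.toLp 2 l, ?_⟩
  have h1 : Tendsto (fun n => fun i => ∑ k ∈ Finset.range n, η k * M k ω i) atTop (𝓝 l) :=
    tendsto_pi_nhds.2 hl
  have h2 := ((PiLp.continuous_toLp 2 fun _ : Fin d => ℝ).tendsto l).comp h1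
  refine h2.congr fun n => ?_
  ext i
  simp

end MartingaleNoise

/-! ### The alternating scheme and the main theorem. -/

/-- The alternating two-player scheme, path by path: if the accumulated perturbations converge, the
interpolation tracks the joint vector field, which vanishes at isolated limit points. -/
theorem alternating_scheme_tracking {E₁ E₂ : Type*} [NormedAddCommGroup E₁] [NormedSpace ℝ E₁]
    [FiniteDimensional ℝ E₁] [NormedAddCommGroup E₂] [NormedSpace ℝ E₂] [FiniteDimensional ℝ E₂]
    {F : E₁ × E₂ → E₁ × E₂} {U : Set (E₁ × E₂)} {K₁ : Set E₁} {K₂ : Set E₂} (hU : IsOpen U)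
    (hK₁ : IsCompact K₁) (hK₂ : IsCompact K₂) (hKU : K₁ ×ˢ K₂ ⊆ U) (hF : LocallyLipschitzOn U F)
    {η : ℕ → ℝ} (hη : ∀ t, 0 < η t) (hη_sum : ¬ Summable η) (hη0 : Tendsto η atTop (𝓝 0))
    {x a : ℕ → E₁} {y b : ℕ → E₂} (hmem : ∀ n, x n ∈ K₁ ∧ y n ∈ K₂)
    (hx : ∀ n, x (n + 1) = x n + η n • (F (x n, y n)).1 + a n)
    (hy : ∀ n, y (n + 1) = y n + η n • (F (x (n + 1), y n)).2 + b n) {l₁ : E₁} {l₂ : E₂}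
    (ha : Tendsto (fun n => ∑ k ∈ Finset.range n, a k) atTop (𝓝 l₁))
    (hb : Tendsto (fun n => ∑ k ∈ Finset.range n, b k) atTop (𝓝 l₂)) :
    IsAsymptoticPseudoTrajectory F U (interpolate η fun n => (x n, y n)) ∧
      ∀ z, IsIsolatedIn z (limitPoints fun n => (x n, y n)) → F z = 0 := by
  have hK : IsCompact (K₁ ×ˢ K₂) := hK₁.prod hK₂
  obtain ⟨L, hL⟩ := (hF.mono hKU).exists_lipschitzOnWith_of_compact hK
  obtain ⟨M, hM⟩ := hK.exists_bound_of_continuousOn hL.continuousOn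
  have hdx : Tendsto (fun n => x (n + 1) - x n) atTop (𝓝 0) :=
    tendsto_increment_zero (d := 0) hη0
      (fun n => (norm_fst_le _).trans (hM (x n, y n) (hmem n)))
      (fun n => by rw [Pi.zero_apply, add_zero]; exact hx n) tendsto_const_nhds
      (tendsto_zero_of_tendsto_sum ha)
  -- The price of rewriting the alternating update as a simultaneous one. `(x (n + 1), y n)` still
  -- lies in the product `K₁ ×ˢ K₂`, so the Lipschitz bound there applies.
  set d : ℕ → E₁ × E₂ := fun n => (0, (F (x (n + 1), y n)).2 - (F (x n, y n)).2) with hd_def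
  have hd : Tendsto d atTop (𝓝 0) := by
    refine squeeze_zero_norm (a := fun n => L * ‖x (n + 1) - x n‖) (fun n => ?_)
      (by simpa using hdx.norm.const_mul (L : ℝ))
    have h1 := hL.dist_le_mul (x (n + 1), y n) ⟨(hmem _).1, (hmem _).2⟩ (x n, y n) (hmem n)
    have h2 : ‖((x (n + 1), y n) : E₁ × E₂) - (x n, y n)‖ = ‖x (n + 1) - x n‖ := by
      simp [Prod.norm_mk]
    rw [dist_eq_norm, dist_eq_norm, h2] at h1
    refine le_trans ?_ h1
    simp only [hd_def, Prod.norm_mk, norm_zero, max_eq_right (norm_nonneg _)]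
    exact norm_snd_le (F (x (n + 1), y n) - F (x n, y n))
  have hrec : ∀ n, ((x (n + 1), y (n + 1)) : E₁ × E₂) =
      (x n, y n) + η n • (F (x n, y n) + d n) + (a n, b n) := fun n => by
    ext1
    · simpa [hd_def] using hx n
    · simpa [hd_def, ← smul_add] using hy n
  have hab : Tendsto (fun n => ∑ k ∈ Finset.range n, (a k, b k)) atTop (𝓝 (l₁, l₂)) := by
    refine (ha.prodMk_nhds hb).congr fun n => ?_
    rw [prod_mk_sum]
  refine ⟨isAsymptoticPseudoTrajectory_interpolate hU hK hKU hF hη hη_sum hη0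
    (z := fun n => (x n, y n)) hmem hrec hd hab, fun z hz => ?_⟩
  have hzlim := hz.tendsto_of_increment hK hmem (tendsto_increment_zero hη0
    (fun n => hM (x n, y n) (hmem n)) hrec hd (tendsto_zero_of_tendsto_sum hab))
  have hzK : z ∈ K₁ ×ˢ K₂ := hK.isClosed.mem_of_tendsto hzlim (Eventually.of_forall hmem)
  have hFz : ContinuousAt F z := hF.continuousOn.continuousAt (hU.mem_nhds (hKU hzK))
  exact eq_zero_of_tendsto_euler hη hη_sum (z := fun n => (x n, y n)) hrec hd hab hzlim
    (hFz.tendsto.comp hzlim)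

/-- Adding a summable bias to a convergent accumulated noise. -/
theorem exists_tendsto_sum_smul_add {E : Type*} [NormedAddCommGroup E] [NormedSpace ℝ E]
    [CompleteSpace E] {η : ℕ → ℝ} {M b : ℕ → E} {l : E}
    (hM : Tendsto (fun n => ∑ k ∈ Finset.range n, η k • M k) atTop (𝓝 l))
    (hb : Summable fun n => ‖η n • b n‖) :
    ∃ l', Tendsto (fun n => ∑ k ∈ Finset.range n, η k • (M k + b k)) atTop (𝓝 l') := by
  refine ⟨_, (hM.add hb.of_norm.hasSum.tendsto_sum_nat).congr fun n => ?_⟩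
  rw [← Finset.sum_add_distrib]
  simp only [smul_add]

theorem mainTheorem2 {p q : ℕ} {Task DU Out S Ω : Type*} [mΩ : MeasurableSpace Ω]
    (P : Measure Ω) [IsProbabilityMeasure P]
    -- the KL-regularized game, with uniformly bounded rewards
    (G : GVGame p q Task DU Out S)
    (hreward : ∃ C : ℝ, ∀ e, |G.rewardF e| ≤ C ∧ |G.rewardV e| ≤ C)
    -- compact parameter domains, near which the objectives are finite and `C¹` and the role
    -- gradients are Lipschitz
    (Kf : Set (EuclideanSpace ℝ (Fin p))) (Kv : Set (EuclideanSpace ℝ (Fin q)))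
    (hKf : IsCompact Kf) (hKv : IsCompact Kv)
    (U : Set (EuclideanSpace ℝ (Fin p) × EuclideanSpace ℝ (Fin q)))
    (hU : IsOpen U) (hKU : Kf ×ˢ Kv ⊆ U)
    (hKL : ∀ z ∈ U, G.klV z.1 z.2 ≠ ⊤ ∧ G.klFX z.1 z.2 ≠ ⊤ ∧ G.klFZ z.1 z.2 ≠ ⊤ ∧
      G.klFA z.1 z.2 ≠ ⊤)
    (hJf : ContDiffOn ℝ 1 (fun z => G.Jf z.1 z.2) U)
    (hJv : ContDiffOn ℝ 1 (fun z => G.Jv z.2 z.1) U)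
    (hLip : LocallyLipschitzOn U G.field)
    -- step sizes
    (η : ℕ → ℝ) (hη : ∀ t, 0 < η t) (hη_sum : ¬ Summable η) (hη_sq : Summable fun t => η t ^ 2)
    -- martingale-difference noise with bounded second moments
    (ℱ : Filtration ℕ mΩ)
    (Mf : ℕ → Ω → EuclideanSpace ℝ (Fin p)) (Mv : ℕ → Ω → EuclideanSpace ℝ (Fin q))
    (hMf_adapted : ∀ t, StronglyMeasurable[ℱ (t + 1)] (Mf (t + 1)))
    (hMv_adapted : ∀ t, StronglyMeasurable[ℱ (t + 1)] (Mv (t + 1)))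
    (hM_memLp : ∀ t, MemLp (Mf (t + 1)) 2 P ∧ MemLp (Mv (t + 1)) 2 P)
    (hM_bound : ∃ C : ℝ, ∀ t, ∫ ω, ‖Mf (t + 1) ω‖ ^ 2 ∂P ≤ C ∧ ∫ ω, ‖Mv (t + 1) ω‖ ^ 2 ∂P ≤ C)
    (hMf_cond : ∀ t, P[Mf (t + 1) | ℱ t] =ᵐ[P] 0)
    (hMv_cond : ∀ t, P[Mv (t + 1) | ℱ t] =ᵐ[P] 0)
    -- summable bias
    (bf : ℕ → Ω → EuclideanSpace ℝ (Fin p)) (bv : ℕ → Ω → EuclideanSpace ℝ (Fin q))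
    (hbias : ∀ᵐ ω ∂P, Summable fun t => η t * (‖bf t ω‖ + ‖bv t ω‖))
    -- the alternating (block-coordinate) iterates, which stay in the parameter domains
    (φ : ℕ → Ω → EuclideanSpace ℝ (Fin p)) (θ : ℕ → Ω → EuclideanSpace ℝ (Fin q))
    (hmem : ∀ᵐ ω ∂P, ∀ t, φ t ω ∈ Kf ∧ θ t ω ∈ Kv)
    (hφ : ∀ᵐ ω ∂P, ∀ t, φ (t + 1) ω =
      φ t ω + η t • (G.gradF (φ t ω) (θ t ω) + Mf (t + 1) ω + bf t ω))
    (hθ : ∀ᵐ ω ∂P, ∀ t, θ (t + 1) ω =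
      θ t ω + η t • (G.gradV (θ t ω) (φ (t + 1) ω) + Mv (t + 1) ω + bv t ω)) :
    (∀ᵐ ω ∂P,
      IsAsymptoticPseudoTrajectory G.field U (interpolate η fun t => (φ t ω, θ t ω)) ∧
      ∀ z, IsIsolatedIn z (limitPoints fun t => (φ t ω, θ t ω)) →
        G.gradF z.1 z.2 = 0 ∧ G.gradV z.2 z.1 = 0) ∧
    ∀ z ∈ U, IsAsymptoticallyStable G.field z →
      G.gradF z.1 z.2 = 0 ∧ G.gradV z.2 z.1 = 0 := by
  have hη0 : Tendsto η atTop (𝓝 0) := by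
    have h := hη_sq.tendsto_atTop_zero.sqrt
    rw [Real.sqrt_zero] at h
    exact h.congr fun t => Real.sqrt_sq (hη t).le
  refine ⟨?_, fun z hz hst => Prod.mk_eq_zero.1
    (hst.eq_zero (hLip.continuousOn.continuousAt (hU.mem_nhds hz)))⟩
  obtain ⟨C, hC⟩ := hM_bound
  filter_upwards [hbias, hmem, hφ, hθ,
    ae_exists_tendsto_sum_smul_noise (M := fun t => Mf (t + 1)) ℱ hη_sq hMf_adapted
      (fun t => (hM_memLp t).1) (fun t => (hC t).1) hMf_cond,
    ae_exists_tendsto_sum_smul_noise (M := fun t => Mv (t + 1)) ℱ hη_sq hMv_adapted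
      (fun t => (hM_memLp t).2) (fun t => (hC t).2) hMv_cond]
    with ω hbω hmω hφω hθω ⟨lf, hlf⟩ ⟨lv, hlv⟩
  -- The bias is handled path by path, by absolute summability, so it needs no adaptedness.
  obtain ⟨lf', hlf'⟩ := exists_tendsto_sum_smul_add hlf (b := fun t => bf t ω)
    (hbω.of_nonneg_of_le (fun t => norm_nonneg _) fun t => by
      rw [norm_smul, Real.norm_of_nonneg (hη t).le]
      exact mul_le_mul_of_nonneg_left (le_add_of_nonneg_right (norm_nonneg _)) (hη t).le)
  obtain ⟨lv', hlv'⟩ := exists_tendsto_sum_smul_add hlv (b := fun t => bv t ω)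
    (hbω.of_nonneg_of_le (fun t => norm_nonneg _) fun t => by
      rw [norm_smul, Real.norm_of_nonneg (hη t).le]
      exact mul_le_mul_of_nonneg_left (le_add_of_nonneg_left (norm_nonneg _)) (hη t).le)
  obtain ⟨h1, h2⟩ := alternating_scheme_tracking (F := G.field) hU hKf hKv hKU hLip hη hη_sum hη0
    (x := fun t => φ t ω) (y := fun t => θ t ω) hmω
    (fun t => by rw [hφω t, add_assoc (G.gradF _ _), smul_add, ← add_assoc]; rfl)
    (fun t => by rw [hθω t, add_assoc (G.gradV _ _), smul_add, ← add_assoc]; rfl) hlf' hlv'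
  exact ⟨h1, fun z hz => Prod.mk_eq_zero.1 (h2 z hz)⟩
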